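/- **Theorem 3 (Residual optimization characterization).** Let $k,l\le n$ and let $V=[\bar V\ \ \bar V^{\perp}]\in\mathbb R^{n\times n}$ satisfy $V^TV=I$, with $\bar V\in\mathbb R^{n\times k}$ and $\bar V^{\perp}\in\mathbb R^{n\times(n-k)}$. Consider the worst-case configuration in which the left and right singular bases coincide, $\bar U=\bar V$ and $\bar U^{\perp}=\bar V^{\perp}$. Let $\epsilon_\sigma\in\mathbb R^{n-k}$ with $0\le(\epsilon_\sigma)_i\le\sigma_\epsilon$ be the non-dominant singular values. Let $I^{(l)}\in\mathbb R^{n\times(n-l)}$ be the matrix whose first $l$ rows are zero and whose last $n-l$ rows form the identity, and let $M=\mathbf 1\mathbf 1^T-I^{(l)}(I^{(l)})^T\mathbf 1\mathbf 1^TI^{(l)}(I^{(l)})^T$ be the mask of the observed entries. Write $\|\cdot\|_F$ for the Frobenius norm and $\ell_1^*$ for the nuclear norm (the sum of the singular values). Consider the residual optimization problem $$\min_{W\in\mathbb R^{n\times n},\ M\circ W=0}\ \operatorname{tr}(\bar U^TW\bar V)+\ell_1^*\big(\operatorname{diag}(\epsilon_\sigma)+(\bar U^{\perp})^TW\bar V^{\perp}\big)\qquad(\ast)$$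 and assume the optimizing condition $$\exists\Lambda:\quad \Lambda^T\Lambda\le I\quad\text{and}\quad (I^{(l)})^T\big(\bar V\bar U^T+\bar V^{\perp}\Lambda(\bar U^{\perp})^T\big)I^{(l)}=0 .$$ Put $B=(I^{(l)})^T\bar V^{\perp}$, let $B^{+}$ be its Moore–Penrose pseudo-inverse, and consider the problem $$\min_{\bar\Lambda\in\mathbb R^{(n-k)\times(n-k)},\ \bar\Lambda(I-B^{+}B)=0}\Big(\tfrac14\big\|(I^{(l)})^T\bar V^{\perp}\bar\Lambda(\bar V^{\perp})^TI^{(l)}\big\|_F^2-\operatorname{tr}\big(\bar\Lambda\operatorname{diag}(\epsilon_\sigma)\big)\Big).\qquad(\ast\ast)$$ 1. If $\epsilon_\sigma=\sigma_\epsilon\mathbf 1$ (the worst case), then the objective of $(\ast\ast)$ is bounded below on its feasible set. 2. Whenever the objective of $(\ast\ast)$ is bounded below on its feasible set, the minimum in $(\ast\ast)$ is attained, $(\ast)$ has a solution of least Frobenius norm $\bar W$, and $$\|\bar W\|_F^2=-\min_{\bar\Lambda,\ \bar\Lambda(I-B^{+}B)=0}\Big(\tfrac14\big\|(I^{(l)})^T\bar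 V^{\perp}\bar\Lambda(\bar V^{\perp})^TI^{(l)}\big\|_F^2-\operatorname{tr}\big(\bar\Lambda\operatorname{diag}(\epsilon_\sigma)\big)\Big).$$ If moreover the optimizing condition holds with $\Lambda^T\Lambda<I$, then $\bar W$ is the only solution of $(\ast)$. -/

import Mathlib

open scoped Matrix Matrix.Norms.Frobenius

namespace BlockCompletion

/-- The Moore-Penrose conditions: `G` is the pseudo-inverse of the real matrix `B`. -/
structure IsPseudoInverse {m q : ℕ} (B : Matrix (Fin m) (Fin q) ℝ)
    (G : Matrix (Fin q) (Fin m) ℝ) : Prop where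
  mul_mul_self : B * G * B = B
  self_mul_mul : G * B * G = G
  isSymm_left : (B * G)ᵀ = B * G
  isSymm_right : (G * B)ᵀ = G * B

theorem IsPseudoInverse.unique {m q : ℕ} {B : Matrix (Fin m) (Fin q) ℝ}
    {G H : Matrix (Fin q) (Fin m) ℝ} (hG : IsPseudoInverse B G) (hH : IsPseudoInverse B H) :
    G = H := by
  have h1 : B * G = B * H := by
    calc B * G = (B * G)ᵀ := hG.isSymm_left.symm
      _ = (B * H * B * G)ᵀ := by rw [hH.mul_mul_self]
      _ = (B * G)ᵀ * (B * H)ᵀ := by rw [Matrix.mul_assoc, Matrix.transpose_mul]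
      _ = B * G * B * H := by rw [hG.isSymm_left, hH.isSymm_left, ← Matrix.mul_assoc]
      _ = B * H := by rw [hG.mul_mul_self]
  have h2 : G * B = H * B := by
    calc G * B = (G * B)ᵀ := hG.isSymm_right.symm
      _ = (G * (B * H * B))ᵀ := by rw [hH.mul_mul_self]
      _ = ((G * B) * (H * B))ᵀ := by simp only [Matrix.mul_assoc]
      _ = (H * B)ᵀ * (G * B)ᵀ := by rw [Matrix.transpose_mul]
      _ = H * (B * G * B) := by
          rw [hG.isSymm_right, hH.isSymm_right]; simp only [Matrix.mul_assoc]
      _ = H * B := by rw [hG.mul_mul_self]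
  calc G = G * B * G := hG.self_mul_mul.symm
    _ = H * B * G := by rw [h2]
    _ = H * (B * G) := by rw [Matrix.mul_assoc]
    _ = H * B * H := by rw [h1, Matrix.mul_assoc]
    _ = H := hH.self_mul_mul

theorem exists_isPseudoInverse {m q : ℕ} (B : Matrix (Fin m) (Fin q) ℝ) :
    ∃ G, IsPseudoInverse B G := by
  obtain ⟨T, hT, h1, h2, h3⟩ : ∃ T : Matrix (Fin q) (Fin q) ℝ, Tᵀ = T ∧
      (Bᵀ * B) * T * (Bᵀ * B) = Bᵀ * B ∧ T * (Bᵀ * B) * T = T ∧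
      (T * (Bᵀ * B))ᵀ = T * (Bᵀ * B) := by
    have hS : (Bᵀ * B).IsHermitian := Matrix.isHermitian_conjTranspose_mul_self B
    obtain ⟨U, d, hU, hd⟩ : ∃ (U : Matrix (Fin q) (Fin q) ℝ) (d : Fin q → ℝ), Uᵀ * U = 1 ∧
        Bᵀ * B = U * Matrix.diagonal d * Uᵀ :=
      ⟨hS.eigenvectorUnitary, hS.eigenvalues,
        Unitary.coe_star_mul_self hS.eigenvectorUnitary, hS.spectral_theorem⟩
    have key : ∀ a b : Fin q → ℝ, (U * Matrix.diagonal a * Uᵀ) * (U * Matrix.diagonal b * Uᵀ)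
        = U * Matrix.diagonal (fun i => a i * b i) * Uᵀ := by
      intro a b
      calc (U * Matrix.diagonal a * Uᵀ) * (U * Matrix.diagonal b * Uᵀ)
          = U * Matrix.diagonal a * (Uᵀ * U) * Matrix.diagonal b * Uᵀ := by
            simp only [Matrix.mul_assoc]
        _ = U * Matrix.diagonal (fun i => a i * b i) * Uᵀ := by
            rw [hU, Matrix.mul_one, Matrix.mul_assoc U, Matrix.diagonal_mul_diagonal]
    have symm : ∀ a : Fin q → ℝ, (U * Matrix.diagonal a * Uᵀ)ᵀ = U * Matrix.diagonal a * Uᵀ := by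
      intro a
      simp [Matrix.transpose_mul, Matrix.mul_assoc]
    refine ⟨U * Matrix.diagonal (fun i => (d i)⁻¹) * Uᵀ, symm _, ?_, ?_, ?_⟩
    · rw [hd, key, key]
      simp
    · rw [hd, key, key]
      congr 3
      funext i
      by_cases h : d i = 0 <;> simp [h]
    · rw [hd, key, symm]
  refine ⟨T * Bᵀ, ?_, ?_, ?_, ?_⟩
  · have h : B * (T * (Bᵀ * B) - 1) = 0 := by
      have h4 := Matrix.conjTranspose_mul_self_mul_eq_zero B (T * (Bᵀ * B) - 1)
      refine h4.mp ?_
      rw [Matrix.conjTranspose_eq_transpose_of_trivial, Matrix.mul_sub, Matrix.mul_one,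
        ← Matrix.mul_assoc, h1, sub_self]
    rw [Matrix.mul_sub, Matrix.mul_one, sub_eq_zero] at h
    simpa only [Matrix.mul_assoc] using h
  · calc T * Bᵀ * B * (T * Bᵀ) = (T * (Bᵀ * B) * T) * Bᵀ := by simp only [Matrix.mul_assoc]
      _ = T * Bᵀ := by rw [h2]
  · simp only [Matrix.transpose_mul, Matrix.transpose_transpose, hT, Matrix.mul_assoc]
  · simpa only [Matrix.mul_assoc] using h3

/-- The pseudo-inverse of a real matrix. -/
noncomputable def pinv {m q : ℕ} (B : Matrix (Fin m) (Fin q) ℝ) : Matrix (Fin q) (Fin m) ℝ :=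
  Classical.choose (exists_isPseudoInverse B)

theorem pinv_spec {m q : ℕ} (B : Matrix (Fin m) (Fin q) ℝ) : IsPseudoInverse B (pinv B) :=
  Classical.choose_spec (exists_isPseudoInverse B)

/-- The nuclear norm: the sum of the singular values. -/
noncomputable def nuclearNorm {p q : ℕ} (X : Matrix (Fin p) (Fin q) ℝ) : ℝ :=
  ∑ i ∈ Finset.range q, (Matrix.toEuclideanLin X).singularValues i

/-- The `n × (n - l)` matrix whose first `l` rows vanish and whose last `n - l` rows form the
identity matrix. -/
def blockSelector (n l : ℕ) : Matrix (Fin n) (Fin (n - l)) ℝ :=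
  Matrix.of fun i j => if (i : ℕ) = l + (j : ℕ) then 1 else 0

/-- The `0/1` mask of the observed entries: everything except the lower right square block of
size `n - l`. -/
def mask (n l : ℕ) : Matrix (Fin n) (Fin n) ℝ :=
  (Matrix.of fun _ _ => 1) - blockSelector n l * (blockSelector n l)ᵀ *
    (Matrix.of fun _ _ => 1) * (blockSelector n l * (blockSelector n l)ᵀ)

/-- Objective of the residual optimization. The columns of `Ub`, `Vb` are the dominant left and
right singular vectors, those of `Up`, `Vp` the remaining ones; `ε` holds the remaining singular
values. -/
noncomputable def residualObjective {n k : ℕ} (Ub Vb : Matrix (Fin n) (Fin k) ℝ)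
    (Up Vp : Matrix (Fin n) (Fin (n - k)) ℝ) (ε : Fin (n - k) → ℝ)
    (W : Matrix (Fin n) (Fin n) ℝ) : ℝ :=
  (Ubᵀ * W * Vb).trace + nuclearNorm (Matrix.diagonal ε + Upᵀ * W * Vp)

/-- `W` solves the residual optimization: it minimizes the objective among all matrices that
vanish on the observed entries. -/
def IsResidualSolution {n k : ℕ} (l : ℕ) (Ub Vb : Matrix (Fin n) (Fin k) ℝ)
    (Up Vp : Matrix (Fin n) (Fin (n - k)) ℝ) (ε : Fin (n - k) → ℝ)
    (W : Matrix (Fin n) (Fin n) ℝ) : Prop :=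
  mask n l ⊙ W = 0 ∧ ∀ W' : Matrix (Fin n) (Fin n) ℝ, mask n l ⊙ W' = 0 →
    residualObjective Ub Vb Up Vp ε W ≤ residualObjective Ub Vb Up Vp ε W'

/-- `W` is a solution of the residual optimization of least Frobenius norm. -/
def IsLeastNormResidualSolution {n k : ℕ} (l : ℕ) (Ub Vb : Matrix (Fin n) (Fin k) ℝ)
    (Up Vp : Matrix (Fin n) (Fin (n - k)) ℝ) (ε : Fin (n - k) → ℝ)
    (W : Matrix (Fin n) (Fin n) ℝ) : Prop :=
  IsResidualSolution l Ub Vb Up Vp ε W ∧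
    ∀ W', IsResidualSolution l Ub Vb Up Vp ε W' → ‖W‖ ≤ ‖W'‖

/-- The dual equation `(I⁽ˡ⁾)ᵀ (V̄ Ūᵀ + V̄^⊥ Λ (Ū^⊥)ᵀ) I⁽ˡ⁾ = 0`. -/
def DualEquation {n k : ℕ} (l : ℕ) (Ub Vb : Matrix (Fin n) (Fin k) ℝ)
    (Up Vp : Matrix (Fin n) (Fin (n - k)) ℝ) (L : Matrix (Fin (n - k)) (Fin (n - k)) ℝ) : Prop :=
  (blockSelector n l)ᵀ * (Vb * Ubᵀ + Vp * L * Upᵀ) * blockSelector n l = 0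

/-- The optimizing condition: the dual equation has a solution with `Λᵀ Λ ≤ I`. -/
def OptimizingCondition {n k : ℕ} (l : ℕ) (Ub Vb : Matrix (Fin n) (Fin k) ℝ)
    (Up Vp : Matrix (Fin n) (Fin (n - k)) ℝ) : Prop :=
  ∃ L : Matrix (Fin (n - k)) (Fin (n - k)) ℝ, (1 - Lᵀ * L).PosSemidef ∧
    DualEquation l Ub Vb Up Vp L

/-- The strict optimizing condition: the dual equation has a solution with `Λᵀ Λ < I`. -/
def StrictOptimizingCondition {n k : ℕ} (l : ℕ) (Ub Vb : Matrix (Fin n) (Fin k) ℝ)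
    (Up Vp : Matrix (Fin n) (Fin (n - k)) ℝ) : Prop :=
  ∃ L : Matrix (Fin (n - k)) (Fin (n - k)) ℝ, (1 - Lᵀ * L).PosDef ∧
    DualEquation l Ub Vb Up Vp L

/-- The matrices `Λ̄` with `Λ̄ (I - B⁺ B) = 0`, where `B = (I⁽ˡ⁾)ᵀ V̄^⊥` is the mask-restricted
basis and `B⁺` its pseudo-inverse. -/
def dualFeasibleSet {n k : ℕ} (l : ℕ) (Vp : Matrix (Fin n) (Fin (n - k)) ℝ) :
    Set (Matrix (Fin (n - k)) (Fin (n - k)) ℝ) :=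
  {L | L * (1 - pinv ((blockSelector n l)ᵀ * Vp) * ((blockSelector n l)ᵀ * Vp)) = 0}

/-- `¼ ‖(I⁽ˡ⁾)ᵀ V̄^⊥ Λ̄ (V̄^⊥)ᵀ I⁽ˡ⁾‖_F² - tr (Λ̄ diag ε)`. -/
noncomputable def dualObjective {n k : ℕ} (l : ℕ) (Vp : Matrix (Fin n) (Fin (n - k)) ℝ)
    (ε : Fin (n - k) → ℝ) (L : Matrix (Fin (n - k)) (Fin (n - k)) ℝ) : ℝ :=
  1 / 4 * ‖(blockSelector n l)ᵀ * (Vp * L * Vpᵀ) * blockSelector n l‖ ^ 2 -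
    (L * Matrix.diagonal ε).trace

end BlockCompletion

namespace BlockCompletion

open Matrix

/-! ### Nuclear norm: duality with contractions, and its value on the semidefinite cone. -/

section NuclearNorm

/-! A matrix vanishing on the observed entries is an `H` placed in the free block. Put `B = (I⁽ˡ⁾)ᵀ
V̄^⊥`, `C = B⁺`, `D = diag ε`, `P = C B`. Orthogonality of `V` turns the dual equation into `B (1 -
Λ) Bᵀ = 1`. Hence `B C = 1`, and the objective becomes `nuclearNorm (D + Bᵀ H B) - tr ((1 - C Cᵀ) Bᵀ
H B)` (`residualObjective_eq_blockObjective`).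

The matrix `1 - C Cᵀ` is a dual certificate. The bound `ΛᵀΛ ≤ 1` gives `2 B Bᵀ ≥ 1`, so `0 ≤ C Cᵀ ≤
2` and the certificate is a contraction; duality bounds the objective below by `tr ((1 - C Cᵀ) D)`.
If `P` commutes with `D`, then `H₀ = -Cᵀ D C` attains this bound.

Commutation is exactly what boundedness of the dual problem supplies: otherwise the quadratic term
vanishes along a line on which the linear term does not (`commute_of_bddBelow`). Completing the
square then gives the dual minimum `-‖Cᵀ D C‖² = -‖H₀‖²`. In the worst case `D` is scalar and
commutation is automatic.

Least norm and uniqueness come from perturbing the certificate to `1 - C Cᵀ + t C M Cᵀ`. While this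
stays a contraction, every minimizer `H` satisfies `tr (M (Cᵀ D C + H)) ≤ 0`
(`trace_conj_mul_nonpos`). The choice `M = Cᵀ D C` gives least norm; under the strict condition `M =
(Cᵀ D C + H)ᵀ` is allowed and forces `H = H₀`. -/

theorem inner_toEuclideanLin_left {p q : ℕ} (A : Matrix (Fin p) (Fin q) ℝ)
    (x : EuclideanSpace ℝ (Fin q)) (y : EuclideanSpace ℝ (Fin p)) :
    inner ℝ (toEuclideanLin A x) y = inner ℝ x (toEuclideanLin Aᵀ y) := by
  rw [← conjTranspose_eq_transpose_of_trivial, toEuclideanLin_conjTranspose_eq_adjoint,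
    LinearMap.adjoint_inner_right]

theorem toEuclideanLin_mul_apply {p q r : ℕ} (A : Matrix (Fin p) (Fin q) ℝ)
    (B : Matrix (Fin q) (Fin r) ℝ) (x : EuclideanSpace ℝ (Fin r)) :
    toEuclideanLin (A * B) x = toEuclideanLin A (toEuclideanLin B x) := by
  rw [toLpLin_mul_same]; rfl

theorem inner_toEuclideanLin_nonneg {q : ℕ} {A : Matrix (Fin q) (Fin q) ℝ} (hA : A.PosSemidef)
    (x : EuclideanSpace ℝ (Fin q)) : 0 ≤ inner ℝ x (toEuclideanLin A x) := by
  have h := hA.dotProduct_mulVec_nonneg x.ofLp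
  rw [EuclideanSpace.inner_eq_star_dotProduct, dotProduct_comm]
  exact h

theorem trace_eq_sum_inner {q : ℕ} (A : Matrix (Fin q) (Fin q) ℝ)
    (e : OrthonormalBasis (Fin q) ℝ (EuclideanSpace ℝ (Fin q))) :
    A.trace = ∑ i, inner ℝ (e i) (toEuclideanLin A (e i)) := by
  rw [← LinearMap.trace_eq_sum_inner, toEuclideanLin_eq_toLin_orthonormal,
    trace_toLin_eq]

theorem norm_toEuclideanLin_le {q : ℕ} {A : Matrix (Fin q) (Fin q) ℝ}
    (hA : (1 - Aᵀ * A).PosSemidef) (x : EuclideanSpace ℝ (Fin q)) :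
    ‖toEuclideanLin A x‖ ≤ ‖x‖ := by
  have h := inner_toEuclideanLin_nonneg hA x
  rw [map_sub, LinearMap.sub_apply, inner_sub_right, toEuclideanLin_mul_apply,
    ← inner_toEuclideanLin_left, toLpLin_one, LinearMap.id_apply, real_inner_self_eq_norm_sq,
    real_inner_self_eq_norm_sq] at h
  exact (sq_le_sq₀ (norm_nonneg _) (norm_nonneg _)).mp (by linarith)

/-- An orthonormal basis of right singular vectors. -/
theorem exists_singular_basis {q : ℕ} (Z : Matrix (Fin q) (Fin q) ℝ) :
    ∃ e : OrthonormalBasis (Fin q) ℝ (EuclideanSpace ℝ (Fin q)),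
      nuclearNorm Z = ∑ i, ‖toEuclideanLin Z (e i)‖ ∧
      ∀ i, toEuclideanLin (Zᵀ * Z) (e i) = ‖toEuclideanLin Z (e i)‖ ^ 2 • e i := by
  set T := toEuclideanLin Z with hT
  have hn : Module.finrank ℝ (EuclideanSpace ℝ (Fin q)) = q := finrank_euclideanSpace_fin
  have hadj : ∀ x, toEuclideanLin (Zᵀ * Z) x = (T.adjoint ∘ₗ T) x := by
    intro x
    rw [toEuclideanLin_mul_apply, ← conjTranspose_eq_transpose_of_trivial,
      toEuclideanLin_conjTranspose_eq_adjoint, LinearMap.comp_apply]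
  let e := T.isSymmetric_adjoint_comp_self.eigenvectorBasis hn
  have he : ∀ i, (T.adjoint ∘ₗ T) (e i) = (T.singularValues i ^ 2) • e i := by
    intro i
    rw [T.sq_singularValues_fin hn]
    exact T.isSymmetric_adjoint_comp_self.apply_eigenvectorBasis hn i
  have hs : ∀ i : Fin q, ‖T (e i)‖ = T.singularValues i := by
    intro i
    have h : ‖T (e i)‖ ^ 2 = T.singularValues i ^ 2 := by
      rw [← real_inner_self_eq_norm_sq, ← LinearMap.adjoint_inner_right, ← LinearMap.comp_apply,
        he, real_inner_smul_right, real_inner_self_eq_norm_sq, e.norm_eq_one]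
      ring
    exact (sq_eq_sq₀ (norm_nonneg _) (T.singularValues_nonneg _)).mp h
  refine ⟨e, ?_, fun i => ?_⟩
  · rw [nuclearNorm, Finset.sum_range]
    exact Finset.sum_congr rfl fun i _ => (hs i).symm
  · rw [hadj, he, hs]

/-- Contractions are dual feasible for the nuclear norm. -/
theorem trace_mul_le_nuclearNorm {q : ℕ} {A : Matrix (Fin q) (Fin q) ℝ}
    (hA : (1 - Aᵀ * A).PosSemidef) (Z : Matrix (Fin q) (Fin q) ℝ) :
    (A * Z).trace ≤ nuclearNorm Z := by
  obtain ⟨e, he, -⟩ := exists_singular_basis Z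
  rw [he, trace_eq_sum_inner _ e]
  refine Finset.sum_le_sum fun i _ => ?_
  rw [toEuclideanLin_mul_apply]
  refine (real_inner_le_norm _ _).trans ?_
  rw [e.norm_eq_one, one_mul]
  exact norm_toEuclideanLin_le hA _

theorem nuclearNorm_eq_trace {q : ℕ} {Z : Matrix (Fin q) (Fin q) ℝ} (hZ : Z.PosSemidef) :
    nuclearNorm Z = Z.trace := by
  obtain ⟨e, he, hsq⟩ := exists_singular_basis Z
  rw [he, trace_eq_sum_inner _ e]
  refine Finset.sum_congr rfl fun i _ => ?_
  have hZt : Zᵀ = Z := hZ.isHermitian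
  specialize hsq i
  rw [hZt, toEuclideanLin_mul_apply] at hsq
  set s := ‖toEuclideanLin Z (e i)‖ with hs
  rcases (norm_nonneg (toEuclideanLin Z (e i))).eq_or_lt with h0 | hpos
  · rw [hs, ← h0, norm_eq_zero.mp h0.symm, inner_zero_right]
  -- From `Z² e = s² e`, the vector `w = Z e - s e` satisfies `Z w = -s w`; since `s > 0` and `Z ≥
  -- 0`, it must vanish.
  · set w := toEuclideanLin Z (e i) - s • e i with hw
    have hZw : toEuclideanLin Z w = -(s • w) := by
      rw [hw, map_sub, map_smul, hsq, pow_two]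
      module
    have h := inner_toEuclideanLin_nonneg hZ w
    rw [hZw, inner_neg_right, real_inner_smul_right, real_inner_self_eq_norm_sq] at h
    have hw0 : w = 0 := by
      have : ‖w‖ ^ 2 ≤ 0 := by
        by_contra hc
        have := mul_pos hpos (not_le.mp hc)
        linarith
      exact norm_eq_zero.mp (pow_eq_zero_iff two_ne_zero |>.mp (le_antisymm this (sq_nonneg _)))
    rw [sub_eq_zero.mp (hw.symm.trans hw0), real_inner_smul_right, real_inner_self_eq_norm_sq,
      e.norm_eq_one]
    ring

end NuclearNorm

/-! ### Semidefinite perturbations, contractions and the Frobenius norm. -/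

section PosSemidef

variable {q : ℕ}

theorem posSemidef_transpose_mul_self {p : ℕ} (A : Matrix (Fin p) (Fin q) ℝ) :
    (Aᵀ * A).PosSemidef := posSemidef_conjTranspose_mul_self A

theorem posSemidef_mul_transpose_self {p : ℕ} (A : Matrix (Fin p) (Fin q) ℝ) :
    (A * Aᵀ).PosSemidef := posSemidef_self_mul_conjTranspose A

theorem posSemidef_conj {p : ℕ} {A : Matrix (Fin q) (Fin q) ℝ} (hA : A.PosSemidef)
    (B : Matrix (Fin p) (Fin q) ℝ) : (B * A * Bᵀ).PosSemidef :=
  hA.mul_mul_conjTranspose_same B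

theorem posSemidef_conj' {p : ℕ} {A : Matrix (Fin q) (Fin q) ℝ} (hA : A.PosSemidef)
    (B : Matrix (Fin q) (Fin p) ℝ) : (Bᵀ * A * B).PosSemidef :=
  hA.conjTranspose_mul_mul_same B

theorem add_smul_one_eq_conj_diagonal {A : Matrix (Fin q) (Fin q) ℝ} (hA : A.IsHermitian) (c : ℝ) :
    A + c • 1 = (hA.eigenvectorUnitary : Matrix (Fin q) (Fin q) ℝ) *
      diagonal (fun i => hA.eigenvalues i + c) *
      (hA.eigenvectorUnitary : Matrix (Fin q) (Fin q) ℝ)ᵀ := by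
  obtain ⟨U, hU⟩ : ∃ U : Matrix (Fin q) (Fin q) ℝ, U = hA.eigenvectorUnitary := ⟨_, rfl⟩
  have h1 : A = U * diagonal hA.eigenvalues * Uᵀ := by rw [hU]; exact hA.spectral_theorem
  have h2 : U * Uᵀ = 1 := by rw [hU]; exact Unitary.coe_mul_star_self hA.eigenvectorUnitary
  rw [← hU]
  have h3 : diagonal (fun i => hA.eigenvalues i + c) =
      diagonal hA.eigenvalues + c • (1 : Matrix (Fin q) (Fin q) ℝ) := by
    rw [smul_one_eq_diagonal, diagonal_add]
  rw [h3, Matrix.mul_add, Matrix.add_mul, ← h1, Matrix.mul_smul, Matrix.mul_one, Matrix.smul_mul,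
    h2]

theorem posSemidef_add_smul_one {A : Matrix (Fin q) (Fin q) ℝ} (hA : A.IsHermitian) {c : ℝ}
    (h : ∀ i, 0 ≤ hA.eigenvalues i + c) : (A + c • 1).PosSemidef := by
  rw [add_smul_one_eq_conj_diagonal hA]
  exact posSemidef_conj (PosSemidef.diagonal h) _

/-- A symmetric matrix becomes positive semidefinite after adding a large multiple of `1`. -/
theorem exists_posSemidef_add_smul_one {A : Matrix (Fin q) (Fin q) ℝ} (hA : Aᵀ = A) :
    ∃ a : ℝ, 0 ≤ a ∧ (A + a • 1).PosSemidef := by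
  have hA' : A.IsHermitian := hA
  refine ⟨∑ i, |hA'.eigenvalues i|, Finset.sum_nonneg fun i _ => abs_nonneg _,
    posSemidef_add_smul_one hA' fun i => ?_⟩
  have := Finset.single_le_sum (f := fun i => |hA'.eigenvalues i|) (fun i _ => abs_nonneg _)
    (Finset.mem_univ i)
  have h2 := neg_abs_le (hA'.eigenvalues i)
  linarith

theorem exists_posSemidef_sub_smul_one {A : Matrix (Fin q) (Fin q) ℝ} (hA : A.PosDef) :
    ∃ c : ℝ, 0 < c ∧ (A - c • 1).PosSemidef := by
  obtain ⟨c, hc, h⟩ : ∃ c : ℝ, 0 < c ∧ ∀ i, c ≤ hA.1.eigenvalues i := by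
    have hinv : ∀ i, 0 ≤ (hA.1.eigenvalues i)⁻¹ := fun i => (inv_pos.mpr (hA.eigenvalues_pos i)).le
    have hsum : 0 < 1 + ∑ i, (hA.1.eigenvalues i)⁻¹ :=
      add_pos_of_pos_of_nonneg one_pos (Finset.sum_nonneg fun i _ => hinv i)
    -- An explicit lower bound for the spectrum; the summand `1` keeps it meaningful when `q = 0`.
    refine ⟨(1 + ∑ i, (hA.1.eigenvalues i)⁻¹)⁻¹, inv_pos.mpr hsum, fun i => ?_⟩
    refine inv_le_of_inv_le₀ (hA.eigenvalues_pos i) ?_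
    have := Finset.single_le_sum (fun i _ => hinv i) (Finset.mem_univ i)
    linarith
  refine ⟨c, hc, ?_⟩
  rw [sub_eq_add_neg, ← neg_smul]
  exact posSemidef_add_smul_one hA.1 fun i => by linarith [h i]

/-- Positive definiteness is stable under small symmetric perturbations. -/
theorem exists_posSemidef_perturbation {A E F : Matrix (Fin q) (Fin q) ℝ} (hA : A.PosDef)
    (hE : Eᵀ = E) (hF : Fᵀ = F) :
    ∃ t : ℝ, 0 < t ∧ (A + t • E + t ^ 2 • F).PosSemidef := by
  obtain ⟨c, hc, hAc⟩ := exists_posSemidef_sub_smul_one hA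
  obtain ⟨a, ha, hEa⟩ := exists_posSemidef_add_smul_one hE
  obtain ⟨b, hb, hFb⟩ := exists_posSemidef_add_smul_one hF
  have hpos : 0 < a + b + 1 := by positivity
  -- The cap at `1` gives `t² ≤ t`, so `t a + t² b ≤ t (a + b + 1) ≤ c`.
  refine ⟨min 1 (c / (a + b + 1)), by positivity, ?_⟩
  set t := min 1 (c / (a + b + 1)) with ht
  have ht0 : 0 < t := by positivity
  have ht1 : t ≤ 1 := min_le_left _ _
  have htc : t * (a + b + 1) ≤ c := (le_div_iff₀ hpos).mp (min_le_right _ _)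
  have hr : 0 ≤ c - t * a - t ^ 2 * b := by
    nlinarith [mul_nonneg (mul_nonneg ht0.le hb) (sub_nonneg.mpr ht1)]
  have : A + t • E + t ^ 2 • F = (A - c • 1) + t • (E + a • 1) + t ^ 2 • (F + b • 1) +
      (c - t * a - t ^ 2 * b) • 1 := by module
  rw [this]
  exact ((hAc.add (hEa.smul ht0.le)).add (hFb.smul (by positivity))).add (PosSemidef.one.smul hr)

theorem exists_posSemidef_one_sub_smul {A : Matrix (Fin q) (Fin q) ℝ} (hA : Aᵀ = A) :
    ∃ t : ℝ, 0 < t ∧ (1 - t • A).PosSemidef := by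
  obtain ⟨t, ht, h⟩ := exists_posSemidef_perturbation (E := -A) (F := 0) PosDef.one
    (by rw [transpose_neg, hA]) (by simp)
  refine ⟨t, ht, ?_⟩
  simpa [sub_eq_add_neg] using h

/-- If `0 ≤ A ≤ 2` then `1 - A` is a contraction. -/
theorem posSemidef_one_sub_transpose_mul_self {A : Matrix (Fin q) (Fin q) ℝ} (h0 : A.PosSemidef)
    (h2 : ((2 : ℝ) • 1 - A).PosSemidef) : (1 - (1 - A)ᵀ * (1 - A)).PosSemidef := by
  have hA : Aᵀ = A := h0.isHermitian
  -- The defect is `A (2 - A)`; multiplying by `½ (A + (2 - A)) = 1` splits it into two congruences.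
  have h : 1 - (1 - A)ᵀ * (1 - A) = (1 / 2 : ℝ) •
      (Aᵀ * ((2 : ℝ) • 1 - A) * A + ((2 : ℝ) • 1 - A)ᵀ * A * ((2 : ℝ) • 1 - A)) := by
    simp only [transpose_sub, transpose_smul, transpose_one, hA, Matrix.sub_mul, Matrix.mul_sub,
      Matrix.smul_mul, Matrix.mul_smul, Matrix.one_mul, Matrix.mul_one]
    module
  rw [h]
  exact ((posSemidef_conj' h2 _).add (posSemidef_conj' h0 _)).smul (by norm_num)

theorem frobenius_norm_sq {p : ℕ} (A : Matrix (Fin p) (Fin q) ℝ) : ‖A‖ ^ 2 = (Aᵀ * A).trace := by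
  rw [frobenius_norm_def, ← Real.sqrt_eq_rpow, Real.sq_sqrt (by positivity)]
  simp only [trace, diag_apply, mul_apply, transpose_apply, Real.norm_eq_abs]
  rw [Finset.sum_comm]
  refine Finset.sum_congr rfl fun i _ => Finset.sum_congr rfl fun j _ => ?_
  norm_num [pow_two]

theorem eq_zero_of_trace_transpose_mul_self {p : ℕ} {A : Matrix (Fin p) (Fin q) ℝ}
    (h : (Aᵀ * A).trace = 0) : A = 0 := by
  rw [← frobenius_norm_sq] at h
  exact norm_eq_zero.mp (pow_eq_zero_iff two_ne_zero |>.mp h)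

end PosSemidef

/-! ### The primal and dual problems for a matrix with a right inverse. -/

section RightInverse

variable {m q : ℕ} {B : Matrix (Fin m) (Fin q) ℝ} {C : Matrix (Fin q) (Fin m) ℝ}
  {D : Matrix (Fin q) (Fin q) ℝ}

theorem transpose_mul_transpose_eq_one (hBC : B * C = 1) : Cᵀ * Bᵀ = 1 := by
  rw [← transpose_mul, hBC, transpose_one]

/-- As `P = C B` is an orthogonal projection, write `2 = 2 P + 2 (1 - P)`. Then `2 P - C Cᵀ` is the
hypothesis conjugated by `C`. -/
theorem posSemidef_two_sub_mul_transpose (hBC : B * C = 1) (hCB : (C * B)ᵀ = C * B)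
    (hB : ((2 : ℝ) • (B * Bᵀ) - 1).PosSemidef) : ((2 : ℝ) • 1 - C * Cᵀ).PosSemidef := by
  have hid : C * B * (C * B) = C * B := by
    rw [Matrix.mul_assoc, ← Matrix.mul_assoc B, hBC, Matrix.one_mul]
  have h : (2 : ℝ) • 1 - C * Cᵀ =
      C * ((2 : ℝ) • (B * Bᵀ) - 1) * Cᵀ + (2 : ℝ) • ((1 - C * B)ᵀ * (1 - C * B)) := by
    have h1 : C * (B * Bᵀ) * Cᵀ = C * B := by
      rw [← Matrix.mul_assoc, Matrix.mul_assoc, ← transpose_mul, hCB, hid]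
    rw [Matrix.mul_sub, Matrix.sub_mul, Matrix.mul_smul, Matrix.smul_mul, h1, Matrix.mul_one,
      transpose_sub, transpose_one, hCB, Matrix.sub_mul, Matrix.mul_sub, Matrix.mul_sub, hid]
    simp only [Matrix.mul_one, Matrix.one_mul]
    module
  rw [h]
  exact (posSemidef_conj hB _).add ((posSemidef_transpose_mul_self _).smul (by norm_num))

/-- Here `R = Cᵀ C` is the inverse of `E = B Bᵀ`. With `T = 2 E - 1 > 0`, the difference `2 - R` is
`½ (T + T²)` conjugated by the invertible `R`. -/
theorem posDef_two_sub_transpose_mul (hBC : B * C = 1) (hCB : (C * B)ᵀ = C * B)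
    (hB : ((2 : ℝ) • (B * Bᵀ) - 1).PosDef) : ((2 : ℝ) • 1 - Cᵀ * C).PosDef := by
  set E := B * Bᵀ with hE
  set R := Cᵀ * C with hR
  set T := (2 : ℝ) • E - 1 with hT
  have hRE : R * E = 1 := by
    have h1 : C * (B * Bᵀ) = Bᵀ := by
      rw [← Matrix.mul_assoc, ← hCB, transpose_mul, Matrix.mul_assoc,
        transpose_mul_transpose_eq_one hBC, Matrix.mul_one]
    rw [hR, hE, Matrix.mul_assoc, h1, transpose_mul_transpose_eq_one hBC]
  have hER : E * R = 1 := mul_eq_one_comm.mp hRE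
  have hRt : Rᵀ = R := by rw [hR, transpose_mul, transpose_transpose]
  have hTt : Tᵀ = T := hB.1
  clear_value R E
  have h : (2 : ℝ) • 1 - R = Rᵀ * ((1 / 2 : ℝ) • (T + Tᵀ * T)) * R := by
    have h1 : T + Tᵀ * T = (2 : ℝ) • ((2 : ℝ) • E - 1) * E := by
      rw [hTt, hT]
      simp only [Matrix.mul_sub, Matrix.sub_mul, Matrix.smul_mul, Matrix.mul_smul, Matrix.one_mul,
        Matrix.mul_one]
      module
    rw [h1, hRt, Matrix.smul_mul, smul_smul, Matrix.mul_smul, Matrix.smul_mul, ← Matrix.mul_assoc,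
      Matrix.mul_assoc _ E R, hER, Matrix.mul_one, Matrix.mul_sub, Matrix.mul_smul, hRE,
      Matrix.mul_one]
    norm_num
  rw [h]
  refine PosDef.conjTranspose_mul_mul_same
    ((hB.add_posSemidef (posSemidef_transpose_mul_self T)).smul (by norm_num)) ?_
  intro x y hxy
  have := congrArg (E *ᵥ ·) hxy
  simpa only [mulVec_mulVec, hER, one_mulVec] using this

/-- For `B C = 1`, the residual objective expressed through the free block `H`. -/
noncomputable def blockObjective (B : Matrix (Fin m) (Fin q) ℝ) (C : Matrix (Fin q) (Fin m) ℝ)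
    (D : Matrix (Fin q) (Fin q) ℝ) (H : Matrix (Fin m) (Fin m) ℝ) : ℝ :=
  nuclearNorm (D + Bᵀ * H * B) - ((1 - C * Cᵀ) * (Bᵀ * H * B)).trace

theorem le_blockObjective (hC : ((2 : ℝ) • 1 - C * Cᵀ).PosSemidef)
    (H : Matrix (Fin m) (Fin m) ℝ) :
    ((1 - C * Cᵀ) * D).trace ≤ blockObjective B C D H := by
  have h := trace_mul_le_nuclearNorm
    (posSemidef_one_sub_transpose_mul_self (posSemidef_mul_transpose_self C) hC) (D + Bᵀ * H * B)
  rw [Matrix.mul_add, trace_add] at h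
  rw [blockObjective]
  linarith

/-- The residue `D + Bᵀ H₀ B` equals `(1 - P) D (1 - P) ≥ 0`, so its nuclear norm is its trace; its
product with `C Cᵀ` has trace zero because `(1 - P) C = 0`. -/
theorem blockObjective_minimizer (hBC : B * C = 1) (hCB : (C * B)ᵀ = C * B)
    (hD : D.PosSemidef) (hcomm : C * B * D = D * (C * B)) :
    blockObjective B C D (-(Cᵀ * D * C)) = ((1 - C * Cᵀ) * D).trace := by
  have hid : C * B * (C * B) = C * B := by
    rw [Matrix.mul_assoc, ← Matrix.mul_assoc B, hBC, Matrix.one_mul]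
  have hX : Bᵀ * (-(Cᵀ * D * C)) * B = -(D * (C * B)) := by
    rw [Matrix.mul_neg, Matrix.neg_mul, ← Matrix.mul_assoc, ← Matrix.mul_assoc, ← transpose_mul,
      hCB, hcomm, Matrix.mul_assoc, Matrix.mul_assoc, hid]
  have hZ : D + -(D * (C * B)) = (1 - C * B)ᵀ * D * (1 - C * B) := by
    rw [transpose_sub, transpose_one, hCB, Matrix.sub_mul, Matrix.one_mul, hcomm, Matrix.mul_sub,
      Matrix.mul_one, Matrix.sub_mul, Matrix.mul_assoc D, hid, sub_self, sub_zero, sub_eq_add_neg]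
  have hS : (C * Cᵀ * (D + -(D * (C * B)))).trace = 0 := by
    have h1 : (D + -(D * (C * B))) * C = 0 := by
      rw [Matrix.add_mul, Matrix.neg_mul, Matrix.mul_assoc, Matrix.mul_assoc, hBC, Matrix.mul_one,
        add_neg_cancel]
    rw [Matrix.mul_assoc, trace_mul_comm, Matrix.mul_assoc, h1, Matrix.mul_zero, trace_zero]
  rw [blockObjective, hX, nuclearNorm_eq_trace (hZ ▸ posSemidef_conj' hD _)]
  simp only [Matrix.sub_mul, Matrix.one_mul, trace_sub, Matrix.mul_add, trace_add] at hS ⊢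
  linarith

/-- Variational inequality at a minimizer of `blockObjective`. -/
theorem trace_conj_mul_nonpos (hBC : B * C = 1) {H M : Matrix (Fin m) (Fin m) ℝ}
    (hH : blockObjective B C D H ≤ ((1 - C * Cᵀ) * D).trace) {t : ℝ} (ht : 0 < t)
    (hA : (1 - (1 - C * Cᵀ + t • (C * M * Cᵀ))ᵀ * (1 - C * Cᵀ + t • (C * M * Cᵀ))).PosSemidef) :
    (M * (Cᵀ * D * C + H)).trace ≤ 0 := by
  have h := trace_mul_le_nuclearNorm hA (D + Bᵀ * H * B)
  have h1 : (C * M * Cᵀ * (D + Bᵀ * H * B)).trace = (M * (Cᵀ * D * C + H)).trace := by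
    have h2 : Cᵀ * (D + Bᵀ * H * B) * C = Cᵀ * D * C + H := by
      rw [Matrix.mul_add, Matrix.add_mul, Matrix.mul_assoc Bᵀ, ← Matrix.mul_assoc Cᵀ Bᵀ,
        transpose_mul_transpose_eq_one hBC, Matrix.one_mul, Matrix.mul_assoc H, hBC,
        Matrix.mul_one]
    rw [← h2, Matrix.mul_assoc C, Matrix.mul_assoc C, trace_mul_comm]
    simp only [Matrix.mul_assoc]
  rw [Matrix.add_mul, trace_add, Matrix.smul_mul, trace_smul, h1, smul_eq_mul] at h
  rw [blockObjective] at hH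
  rw [Matrix.mul_add, trace_add] at h
  have : t * (M * (Cᵀ * D * C + H)).trace ≤ 0 := by linarith
  exact nonpos_of_mul_nonpos_right this ht

/-- With `M = Cᵀ D C ≥ 0` the perturbed certificate is `1 - C (1 - t M) Cᵀ`, a contraction for small
`t`. So `tr (M (M + H)) ≤ 0`, which combines with `‖M + H‖² ≥ 0`. -/
theorem norm_le_of_blockObjective_le (hBC : B * C = 1)
    (hC : ((2 : ℝ) • 1 - C * Cᵀ).PosSemidef) (hD : D.PosSemidef) {H : Matrix (Fin m) (Fin m) ℝ}
    (hH : blockObjective B C D H ≤ ((1 - C * Cᵀ) * D).trace) : ‖Cᵀ * D * C‖ ≤ ‖H‖ := by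
  set M := Cᵀ * D * C with hM
  have hMpos : M.PosSemidef := posSemidef_conj' hD C
  have hMt : Mᵀ = M := hMpos.isHermitian
  obtain ⟨t, ht, htM⟩ := exists_posSemidef_one_sub_smul hMt
  have hA : 1 - C * Cᵀ + t • (C * M * Cᵀ) = 1 - C * (1 - t • M) * Cᵀ := by
    simp only [Matrix.mul_sub, Matrix.sub_mul, Matrix.mul_one, Matrix.mul_smul, Matrix.smul_mul]
    abel
  have h2 : ((2 : ℝ) • 1 - C * (1 - t • M) * Cᵀ).PosSemidef := by
    have : (2 : ℝ) • 1 - C * (1 - t • M) * Cᵀ = (2 : ℝ) • 1 - C * Cᵀ + t • (C * M * Cᵀ) := by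
      simp only [Matrix.mul_sub, Matrix.sub_mul, Matrix.mul_one, Matrix.mul_smul, Matrix.smul_mul]
      abel
    rw [this]
    exact hC.add ((posSemidef_conj hMpos C).smul ht.le)
  have h := trace_conj_mul_nonpos (M := M) hBC hH ht
    (by rw [hA]; exact posSemidef_one_sub_transpose_mul_self (posSemidef_conj htM C) h2)
  have h3 : 0 ≤ ‖M + H‖ ^ 2 := by positivity
  have h4 : (Hᵀ * M).trace = (M * H).trace := by
    rw [← trace_transpose, transpose_mul, transpose_transpose, hMt]
  have h5 := frobenius_norm_sq M
  rw [frobenius_norm_sq, transpose_add, Matrix.add_mul, Matrix.mul_add, Matrix.mul_add, trace_add,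
    trace_add, trace_add, hMt, h4, ← frobenius_norm_sq H] at h3
  rw [Matrix.mul_add, trace_add] at h
  rw [hMt] at h5
  exact (sq_le_sq₀ (norm_nonneg _) (norm_nonneg _)).mp (by linarith)

/-- The contraction defect factors as `C (⋯) Cᵀ` with middle `2 - Cᵀ C` at `t = 0`. Strictness there
absorbs any small perturbation, including the direction `Kᵀ`, and yields `tr (Kᵀ K) ≤ 0`. -/
theorem eq_of_blockObjective_le (hBC : B * C = 1)
    (hC : ((2 : ℝ) • 1 - Cᵀ * C).PosDef) {H : Matrix (Fin m) (Fin m) ℝ}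
    (hH : blockObjective B C D H ≤ ((1 - C * Cᵀ) * D).trace) : H = -(Cᵀ * D * C) := by
  set K := Cᵀ * D * C + H with hK
  set R := Cᵀ * C with hR
  have hRt : Rᵀ = R := by rw [hR, transpose_mul, transpose_transpose]
  obtain ⟨t, ht, h⟩ := exists_posSemidef_perturbation (E := -(K * (1 - R) + (1 - R) * Kᵀ))
    (F := -(K * R * Kᵀ)) hC
    (by simp only [transpose_neg, transpose_add, transpose_mul, transpose_sub, transpose_one, hRt,
          transpose_transpose, add_comm])
    (by simp only [transpose_neg, transpose_mul, hRt, transpose_transpose, Matrix.mul_assoc])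
  have hA : 1 - (1 - C * Cᵀ + t • (C * Kᵀ * Cᵀ))ᵀ * (1 - C * Cᵀ + t • (C * Kᵀ * Cᵀ)) =
      C * ((2 : ℝ) • 1 - R + t • -(K * (1 - R) + (1 - R) * Kᵀ) + t ^ 2 • -(K * R * Kᵀ)) * Cᵀ := by
    simp only [hR, transpose_add, transpose_sub, transpose_one, transpose_smul, transpose_mul,
      transpose_transpose, Matrix.add_mul, Matrix.mul_add, Matrix.sub_mul, Matrix.mul_sub,
      Matrix.smul_mul, Matrix.mul_smul, Matrix.mul_one, Matrix.one_mul, Matrix.mul_neg,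
      Matrix.neg_mul, Matrix.mul_assoc]
    module
  have h0 := trace_conj_mul_nonpos (M := Kᵀ) hBC hH ht (by rw [hA]; exact posSemidef_conj h C)
  have hK0 : K = 0 := eq_zero_of_trace_transpose_mul_self
    (le_antisymm h0 (posSemidef_transpose_mul_self K).trace_nonneg)
  rw [eq_neg_iff_add_eq_zero, add_comm]
  exact hK0

/-- The dual objective expressed through the restricted basis `B`. -/
noncomputable def blockDualObjective (B : Matrix (Fin m) (Fin q) ℝ)
    (D L : Matrix (Fin q) (Fin q) ℝ) : ℝ :=
  1 / 4 * ‖B * L * Bᵀ‖ ^ 2 - (L * D).trace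

/-- Boundedness of the dual problem forces `D` to commute with the projection `C B`. -/
theorem commute_of_bddBelow (hBC : B * C = 1) (hCB : (C * B)ᵀ = C * B) (hD : Dᵀ = D)
    (h : BddBelow (blockDualObjective B D '' {L | L * (1 - C * B) = 0})) :
    C * B * D = D * (C * B) := by
  have hid : C * B * (C * B) = C * B := by
    rw [Matrix.mul_assoc, ← Matrix.mul_assoc B, hBC, Matrix.one_mul]
  have hBP : B * (1 - C * B) = 0 := by
    rw [Matrix.mul_sub, Matrix.mul_one, ← Matrix.mul_assoc, hBC, Matrix.one_mul, sub_self]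
  have hQt : (1 - C * B)ᵀ = 1 - C * B := by rw [transpose_sub, transpose_one, hCB]
  set G := C * B * D * (1 - C * B) with hG
  have hGt : Gᵀ = (1 - C * B) * D * (C * B) := by
    rw [hG, transpose_mul, transpose_mul, hCB, hQt, hD, ← Matrix.mul_assoc]
  obtain ⟨b, hb⟩ := h
  -- Along the feasible line `s Gᵀ` the quadratic term dies since `B (1 - P) = 0`, leaving the slope
  -- `-‖G‖²`.
  have hval : ∀ s : ℝ, b ≤ -(s * (Gᵀ * G).trace) := by
    intro s
    have hmem : s • Gᵀ ∈ {L : Matrix (Fin q) (Fin q) ℝ | L * (1 - C * B) = 0} := by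
      rw [Set.mem_ofPred_eq, Matrix.smul_mul, hGt, Matrix.mul_sub, Matrix.mul_one,
        Matrix.mul_assoc _ (C * B) (C * B), hid, sub_self, smul_zero]
    have h1 := hb ⟨_, hmem, rfl⟩
    have h2 : B * (s • Gᵀ) * Bᵀ = 0 := by
      rw [Matrix.mul_smul, hGt, Matrix.mul_assoc _ D, ← Matrix.mul_assoc, hBP, Matrix.zero_mul,
        smul_zero, Matrix.zero_mul]
    have h3 : (Gᵀ * D).trace = (Gᵀ * G).trace := by
      have hQ : (1 - C * B) * (1 - C * B) = 1 - C * B := by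
        rw [Matrix.sub_mul, Matrix.one_mul, Matrix.mul_assoc, hBP, Matrix.mul_zero, sub_zero]
      have h4 : Gᵀ = Gᵀ * (C * B) := by
        rw [hGt, Matrix.mul_assoc _ (C * B), hid]
      have h5 : (1 - C * B) * Gᵀ = Gᵀ := by
        rw [hGt, Matrix.mul_assoc _ D, ← Matrix.mul_assoc, hQ]
      calc (Gᵀ * D).trace = ((1 - C * B) * (Gᵀ * (C * B)) * D).trace := by rw [← h4, h5]
        _ = (Gᵀ * G).trace := by
          rw [Matrix.mul_assoc, trace_mul_comm, hG]
          simp only [Matrix.mul_assoc]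
    rw [blockDualObjective, h2, norm_zero, Matrix.smul_mul, trace_smul, h3, smul_eq_mul] at h1
    linarith
  have htr : (Gᵀ * G).trace = 0 := by
    by_contra hne
    -- This `s` makes the value `b - 1`, below the bound.
    have := hval ((-b + 1) / (Gᵀ * G).trace)
    rw [div_mul_cancel₀ _ hne] at this
    linarith
  have hG0 : G = 0 := eq_zero_of_trace_transpose_mul_self htr
  have h1 : C * B * D = C * B * D * (C * B) := by
    rw [hG, Matrix.mul_sub, Matrix.mul_one, sub_eq_zero] at hG0
    exact hG0
  have h2 : D * (C * B) = C * B * D * (C * B) := by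
    have := congrArg transpose h1
    simpa only [transpose_mul _ D, transpose_mul _ (C * B), hCB, hD, ← Matrix.mul_assoc (C * B)]
      using this
  rw [h1, ← h2]

/-- The value of the dual problem. -/
theorem isLeast_blockDualObjective (hBC : B * C = 1) (hCB : (C * B)ᵀ = C * B) (hD : Dᵀ = D)
    (hcomm : C * B * D = D * (C * B)) :
    IsLeast (blockDualObjective B D '' {L | L * (1 - C * B) = 0}) (-‖Cᵀ * D * C‖ ^ 2) := by
  set M := Cᵀ * D * C with hM
  have hMt : Mᵀ = M := by
    rw [hM, transpose_mul, transpose_mul, hD, transpose_transpose, Matrix.mul_assoc]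
  have hMsq : ‖M‖ ^ 2 = (M * M).trace := by rw [frobenius_norm_sq, hMt]
  have hid : C * B * (C * B) = C * B := by
    rw [Matrix.mul_assoc, ← Matrix.mul_assoc B, hBC, Matrix.one_mul]
  have htr : ∀ L : Matrix (Fin q) (Fin q) ℝ, L * (1 - C * B) = 0 →
      (L * D).trace = (B * L * Bᵀ * M).trace := by
    intro L hL
    have h1 : L * (C * B) = L := by
      rw [Matrix.mul_sub, Matrix.mul_one, sub_eq_zero] at hL
      exact hL.symm
    have h2 : Bᵀ * M * B = C * B * D := by
      rw [hM, ← Matrix.mul_assoc, ← Matrix.mul_assoc, ← transpose_mul, hCB, hcomm,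
        Matrix.mul_assoc, Matrix.mul_assoc, hid]
    calc (L * D).trace = (L * (C * B * D)).trace := by rw [← Matrix.mul_assoc, h1]
      _ = (B * L * Bᵀ * M).trace := by
        rw [← h2, ← Matrix.mul_assoc, trace_mul_comm]
        simp only [Matrix.mul_assoc]
  -- With `N = B L Bᵀ`, the objective is `‖½ N - M‖² - ‖M‖²`; this witness has `N = 2 M`.
  refine ⟨⟨(2 : ℝ) • (C * M * Cᵀ), ?_, ?_⟩, ?_⟩
  · have h1 : Cᵀ * (C * B) = Cᵀ := by
      rw [← hCB, transpose_mul, ← Matrix.mul_assoc, transpose_mul_transpose_eq_one hBC,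
        Matrix.one_mul]
    rw [Set.mem_ofPred_eq, Matrix.mul_sub, Matrix.mul_one, Matrix.smul_mul, Matrix.mul_assoc _ Cᵀ,
      h1, sub_self]
  · have hN : B * ((2 : ℝ) • (C * M * Cᵀ)) * Bᵀ = (2 : ℝ) • M := by
      rw [Matrix.mul_smul, Matrix.smul_mul, Matrix.mul_assoc C, ← Matrix.mul_assoc B, hBC,
        Matrix.one_mul, Matrix.mul_assoc, transpose_mul_transpose_eq_one hBC, Matrix.mul_one]
    have htr2 : ((2 : ℝ) • (C * M * Cᵀ) * D).trace = 2 * (M * M).trace := by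
      rw [Matrix.smul_mul, trace_smul, smul_eq_mul, Matrix.mul_assoc, Matrix.mul_assoc,
        trace_mul_comm, Matrix.mul_assoc M]
    rw [blockDualObjective, hN, htr2, norm_smul, mul_pow, hMsq, Real.norm_ofNat]
    ring
  · rintro _ ⟨L, hL, rfl⟩
    rw [blockDualObjective, htr L hL]
    set N := B * L * Bᵀ
    have h1 : 0 ≤ ‖(1 / 2 : ℝ) • N - M‖ ^ 2 := by positivity
    have h2 : (Nᵀ * M).trace = (N * M).trace := by
      rw [← trace_transpose, transpose_mul, transpose_transpose, hMt, trace_mul_comm]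
    rw [frobenius_norm_sq, transpose_sub, transpose_smul, hMt] at h1
    simp only [Matrix.sub_mul, Matrix.mul_sub, Matrix.smul_mul, Matrix.mul_smul, trace_sub,
      trace_smul, smul_eq_mul, h2, trace_mul_comm M N, ← frobenius_norm_sq N, ← hMsq] at h1
    linarith

end RightInverse

/-! ### The block selector and the mask. -/

section Selector

variable {n l : ℕ}

theorem blockSelector_mul_transpose :
    blockSelector n l * (blockSelector n l)ᵀ = diagonal fun i : Fin n => if l ≤ (i : ℕ) then 1 else 0 := by
  ext i i'
  rw [mul_apply, diagonal_apply]
  simp only [blockSelector, of_apply, transpose_apply, mul_ite, mul_one, mul_zero]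
  by_cases h : l ≤ (i : ℕ)
  · rw [Finset.sum_eq_single ⟨(i : ℕ) - l, by omega⟩]
    · simp only [Fin.ext_iff]
      split_ifs <;> first | rfl | omega
    · intro j _ hj
      rw [ne_eq, Fin.ext_iff] at hj
      simp only at hj
      split_ifs <;> first | rfl | omega
    · simp
  · rw [Finset.sum_eq_zero]
    · split_ifs <;> rfl
    · intro j _
      split_ifs <;> first | rfl | omega

theorem transpose_mul_blockSelector : (blockSelector n l)ᵀ * blockSelector n l = 1 := by
  ext j j'
  rw [mul_apply, one_apply]
  simp only [blockSelector, of_apply, transpose_apply, mul_ite, mul_one, mul_zero]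
  rw [Finset.sum_eq_single ⟨l + (j : ℕ), by omega⟩]
  · simp only [Fin.ext_iff]
    split_ifs <;> first | rfl | omega
  · intro i _ hi
    rw [ne_eq, Fin.ext_iff] at hi
    split_ifs <;> rfl
  · simp

theorem mask_hadamard (W : Matrix (Fin n) (Fin n) ℝ) :
    mask n l ⊙ W = W - blockSelector n l *
      ((blockSelector n l)ᵀ * W * blockSelector n l) * (blockSelector n l)ᵀ := by
  have h : blockSelector n l * ((blockSelector n l)ᵀ * W * blockSelector n l) *
      (blockSelector n l)ᵀ = blockSelector n l * (blockSelector n l)ᵀ * W *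
        (blockSelector n l * (blockSelector n l)ᵀ) := by simp only [Matrix.mul_assoc]
  rw [h, mask, blockSelector_mul_transpose]
  ext i j
  simp only [hadamard_apply, Matrix.sub_apply, mul_diagonal, diagonal_mul, of_apply]
  ring

theorem mask_hadamard_eq_zero_iff (W : Matrix (Fin n) (Fin n) ℝ) :
    mask n l ⊙ W = 0 ↔ ∃ H : Matrix (Fin (n - l)) (Fin (n - l)) ℝ,
      W = blockSelector n l * H * (blockSelector n l)ᵀ := by
  rw [mask_hadamard, sub_eq_zero]
  refine ⟨fun h => ⟨_, h⟩, ?_⟩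
  rintro ⟨H, rfl⟩
  have h : (blockSelector n l)ᵀ * (blockSelector n l * H * (blockSelector n l)ᵀ) *
      blockSelector n l = H := by
    rw [Matrix.mul_assoc _ H, ← Matrix.mul_assoc, transpose_mul_blockSelector, Matrix.one_mul,
      Matrix.mul_assoc, transpose_mul_blockSelector, Matrix.mul_one]
  rw [h]

theorem norm_blockSelector_conj (H : Matrix (Fin (n - l)) (Fin (n - l)) ℝ) :
    ‖blockSelector n l * H * (blockSelector n l)ᵀ‖ = ‖H‖ := by
  refine (sq_eq_sq₀ (norm_nonneg _) (norm_nonneg _)).mp ?_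
  rw [frobenius_norm_sq, frobenius_norm_sq, transpose_mul, transpose_mul, transpose_transpose,
    trace_mul_comm, Matrix.mul_assoc (blockSelector n l) H,
    Matrix.mul_assoc (blockSelector n l), Matrix.mul_assoc H,
    ← Matrix.mul_assoc (blockSelector n l)ᵀ, transpose_mul_blockSelector, Matrix.one_mul,
    trace_mul_comm, Matrix.mul_assoc, Matrix.mul_assoc, transpose_mul_blockSelector,
    Matrix.mul_one, trace_mul_comm]

end Selector

/-! ### Reduction of the original problem to the free block. -/

section Restriction

variable {n k l : ℕ} {Vb : Matrix (Fin n) (Fin k) ℝ} {Vp : Matrix (Fin n) (Fin (n - k)) ℝ}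

theorem mul_transpose_add_mul_transpose (hk : k ≤ n)
    (hV : (fromCols Vb Vp)ᵀ * fromCols Vb Vp = 1) : Vb * Vbᵀ + Vp * Vpᵀ = 1 := by
  have hcard : Fintype.card (Fin k ⊕ Fin (n - k)) = Fintype.card (Fin n) := by
    rw [Fintype.card_sum, Fintype.card_fin, Fintype.card_fin, Fintype.card_fin]
    omega
  have h := (mul_eq_one_comm_of_card_eq _ _ _ hcard).mp hV
  rwa [transpose_fromCols, fromCols_mul_fromRows] at h

theorem restricted_gram_add (hk : k ≤ n) (hV : (fromCols Vb Vp)ᵀ * fromCols Vb Vp = 1) :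
    (blockSelector n l)ᵀ * Vb * ((blockSelector n l)ᵀ * Vb)ᵀ +
      (blockSelector n l)ᵀ * Vp * ((blockSelector n l)ᵀ * Vp)ᵀ = 1 := by
  have h := congrArg (fun X => (blockSelector n l)ᵀ * X * blockSelector n l)
    (mul_transpose_add_mul_transpose hk hV)
  simp only [Matrix.mul_one, transpose_mul_blockSelector, Matrix.mul_add, Matrix.add_mul] at h
  simpa only [transpose_mul, transpose_transpose, Matrix.mul_assoc] using h

theorem DualEquation.restricted (hk : k ≤ n) (hV : (fromCols Vb Vp)ᵀ * fromCols Vb Vp = 1)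
    {L : Matrix (Fin (n - k)) (Fin (n - k)) ℝ} (hL : DualEquation l Vb Vb Vp Vp L) :
    (blockSelector n l)ᵀ * Vp * ((1 - L) * ((blockSelector n l)ᵀ * Vp)ᵀ) = 1 := by
  have h := restricted_gram_add (l := l) hk hV
  rw [DualEquation, Matrix.mul_add, Matrix.add_mul] at hL
  rw [Matrix.sub_mul, Matrix.one_mul, Matrix.mul_sub, ← h]
  simp only [transpose_mul, transpose_transpose, Matrix.mul_assoc] at hL ⊢
  rw [eq_neg_of_add_eq_zero_left hL]
  abel

variable {m q : ℕ} {B : Matrix (Fin m) (Fin q) ℝ} {C : Matrix (Fin q) (Fin m) ℝ}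

theorem mul_pinv_eq_one {X : Matrix (Fin q) (Fin m) ℝ} (h : B * X = 1) : B * pinv B = 1 := by
  have h1 := congrArg (· * X) (pinv_spec B).mul_mul_self
  simpa only [Matrix.mul_assoc, h, Matrix.mul_one] using h1

/-- The hypothesis says `B Bᵀ - 1 = B L Bᵀ`, which is symmetric, so `L` may be replaced by `½ (L +
Lᵀ)`; then `2 + L + Lᵀ = (1 + L)ᵀ (1 + L) + (1 - Lᵀ L)`. -/
theorem two_smul_gram_sub_one {L : Matrix (Fin q) (Fin q) ℝ} (h : B * ((1 - L) * Bᵀ) = 1) :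
    (2 : ℝ) • (B * Bᵀ) - 1 =
      B * ((1 / 2 : ℝ) • ((1 + L)ᵀ * (1 + L) + (1 - Lᵀ * L))) * Bᵀ := by
  have h1 : B * Bᵀ - 1 = B * L * Bᵀ := by
    rw [← h]
    rw [Matrix.sub_mul, Matrix.one_mul, Matrix.mul_sub, Matrix.mul_assoc]
    abel
  have h2 : B * Bᵀ - 1 = B * Lᵀ * Bᵀ := by
    have := congrArg transpose h1
    simpa only [transpose_sub, transpose_mul, transpose_transpose, transpose_one,
      Matrix.mul_assoc] using this
  have h3 : (1 + L)ᵀ * (1 + L) + (1 - Lᵀ * L) = (2 : ℝ) • 1 + L + Lᵀ := by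
    rw [transpose_add, transpose_one, Matrix.add_mul, Matrix.mul_add, Matrix.one_mul,
      Matrix.one_mul, Matrix.mul_add, Matrix.mul_one]
    module
  rw [h3, Matrix.mul_smul, Matrix.smul_mul, Matrix.mul_add, Matrix.mul_add, Matrix.add_mul,
    Matrix.add_mul, ← h1, ← h2, Matrix.mul_smul, Matrix.smul_mul, Matrix.mul_one]
  module

theorem posSemidef_two_smul_gram_sub_one {L : Matrix (Fin q) (Fin q) ℝ}
    (hL : (1 - Lᵀ * L).PosSemidef) (h : B * ((1 - L) * Bᵀ) = 1) :
    ((2 : ℝ) • (B * Bᵀ) - 1).PosSemidef := by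
  rw [two_smul_gram_sub_one h]
  exact posSemidef_conj (((posSemidef_transpose_mul_self _).add hL).smul (by norm_num)) _

theorem posDef_two_smul_gram_sub_one {L : Matrix (Fin q) (Fin q) ℝ}
    (hL : (1 - Lᵀ * L).PosDef) (h : B * ((1 - L) * Bᵀ) = 1) :
    ((2 : ℝ) • (B * Bᵀ) - 1).PosDef := by
  rw [two_smul_gram_sub_one h]
  refine PosDef.mul_mul_conjTranspose_same
    ((hL.posSemidef_add (posSemidef_transpose_mul_self _)).smul (by norm_num)) ?_
  intro x y hxy
  have := congrArg (· ᵥ* ((1 - L) * Bᵀ)) hxy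
  simpa only [vecMul_vecMul, h, vecMul_one] using this

/-- The dominant trace is `tr H - tr (Bᵀ H B)` by the Gram identity, and `B C = 1` rewrites `tr H`
as `tr (C Cᵀ Bᵀ H B)`. -/
theorem residualObjective_eq_blockObjective (hk : k ≤ n)
    (hV : (fromCols Vb Vp)ᵀ * fromCols Vb Vp = 1) {C : Matrix (Fin (n - k)) (Fin (n - l)) ℝ}
    (hBC : (blockSelector n l)ᵀ * Vp * C = 1) (ε : Fin (n - k) → ℝ)
    (H : Matrix (Fin (n - l)) (Fin (n - l)) ℝ) :
    residualObjective Vb Vb Vp Vp ε (blockSelector n l * H * (blockSelector n l)ᵀ) =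
      blockObjective ((blockSelector n l)ᵀ * Vp) C (diagonal ε) H := by
  have hAB := restricted_gram_add (l := l) hk hV
  set A := (blockSelector n l)ᵀ * Vb with hA
  set B := (blockSelector n l)ᵀ * Vp with hB
  have h1 : Vbᵀ * (blockSelector n l * H * (blockSelector n l)ᵀ) * Vb = Aᵀ * H * A := by
    simp only [hA, transpose_mul, transpose_transpose, Matrix.mul_assoc]
  have h2 : Vpᵀ * (blockSelector n l * H * (blockSelector n l)ᵀ) * Vp = Bᵀ * H * B := by
    simp only [hB, transpose_mul, transpose_transpose, Matrix.mul_assoc]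
  have h3 : (Aᵀ * H * A).trace = H.trace - (Bᵀ * H * B).trace := by
    rw [trace_mul_cycle, trace_mul_cycle Bᵀ, eq_sub_iff_add_eq, ← trace_add, ← Matrix.add_mul, hAB,
      Matrix.one_mul]
  have h4 : (C * Cᵀ * (Bᵀ * H * B)).trace = H.trace := by
    rw [Matrix.mul_assoc, Matrix.mul_assoc Bᵀ, ← Matrix.mul_assoc Cᵀ,
      transpose_mul_transpose_eq_one hBC, Matrix.one_mul, trace_mul_comm, Matrix.mul_assoc, hBC,
      Matrix.mul_one]
  rw [residualObjective, blockObjective, h1, h2, h3, Matrix.sub_mul, Matrix.one_mul, trace_sub, h4]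
  ring

theorem dualObjective_eq_blockDualObjective (ε : Fin (n - k) → ℝ) :
    dualObjective l Vp ε = blockDualObjective ((blockSelector n l)ᵀ * Vp) (diagonal ε) := by
  funext L
  simp only [dualObjective, blockDualObjective, transpose_mul, transpose_transpose,
    Matrix.mul_assoc]

end Restriction
end BlockCompletion

/-! ### The main theorem. -/

theorem theorem3 (n k l : ℕ) (hk : k ≤ n) (hl : l ≤ n)
    (Vb : Matrix (Fin n) (Fin k) ℝ) (Vp : Matrix (Fin n) (Fin (n - k)) ℝ)
    (hV : (Matrix.fromCols Vb Vp)ᵀ * Matrix.fromCols Vb Vp = 1)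
    (σε : ℝ) (ε : Fin (n - k) → ℝ) (hε : ∀ i, 0 ≤ ε i ∧ ε i ≤ σε)
    (hopt : BlockCompletion.OptimizingCondition l Vb Vb Vp Vp) :
    ((∀ i, ε i = σε) → BddBelow
      (BlockCompletion.dualObjective l Vp ε '' BlockCompletion.dualFeasibleSet l Vp)) ∧
    (BddBelow (BlockCompletion.dualObjective l Vp ε '' BlockCompletion.dualFeasibleSet l Vp) →
      ∃ (W : Matrix (Fin n) (Fin n) ℝ) (μ : ℝ),
        BlockCompletion.IsLeastNormResidualSolution l Vb Vb Vp Vp ε W ∧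
        IsLeast (BlockCompletion.dualObjective l Vp ε '' BlockCompletion.dualFeasibleSet l Vp) μ ∧
        ‖W‖ ^ 2 = -μ ∧
        (BlockCompletion.StrictOptimizingCondition l Vb Vb Vp Vp →
          ∀ W', BlockCompletion.IsResidualSolution l Vb Vb Vp Vp ε W' → W' = W)) := by
  obtain ⟨L, hL, hdual⟩ := hopt
  have hBL := hdual.restricted hk hV
  rw [BlockCompletion.dualObjective_eq_blockDualObjective, BlockCompletion.dualFeasibleSet]
  have hBC := BlockCompletion.mul_pinv_eq_one hBL
  have hobj := BlockCompletion.residualObjective_eq_blockObjective hk hV hBC ε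
  have hCB := (BlockCompletion.pinv_spec ((BlockCompletion.blockSelector n l)ᵀ * Vp)).isSymm_right
  have hC := BlockCompletion.posSemidef_two_sub_mul_transpose hBC hCB
    (BlockCompletion.posSemidef_two_smul_gram_sub_one hL hBL)
  have hstrict : BlockCompletion.StrictOptimizingCondition l Vb Vb Vp Vp →
      ((2 : ℝ) • 1 - (BlockCompletion.pinv ((BlockCompletion.blockSelector n l)ᵀ * Vp))ᵀ *
        BlockCompletion.pinv ((BlockCompletion.blockSelector n l)ᵀ * Vp)).PosDef := by
    rintro ⟨L', hL', hdual'⟩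
    exact BlockCompletion.posDef_two_sub_transpose_mul hBC hCB
      (BlockCompletion.posDef_two_smul_gram_sub_one hL' (hdual'.restricted hk hV))
  -- From here `B` and `C` enter only through the facts collected above.
  generalize (BlockCompletion.blockSelector n l)ᵀ * Vp = B at *
  generalize BlockCompletion.pinv B = C at *
  have hD : (Matrix.diagonal ε).PosSemidef := Matrix.PosSemidef.diagonal fun i => (hε i).1
  have hDt : (Matrix.diagonal ε)ᵀ = Matrix.diagonal ε := Matrix.diagonal_transpose ε
  refine ⟨fun hσ => ?_, fun hbdd => ?_⟩
  · have hDσ : Matrix.diagonal ε = σε • 1 := by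
      rw [Matrix.smul_one_eq_diagonal, funext hσ]
    exact (BlockCompletion.isLeast_blockDualObjective hBC hCB hDt
      (by rw [hDσ, Matrix.mul_smul, Matrix.smul_mul, Matrix.mul_one, Matrix.one_mul])).bddBelow
  · have hcomm := BlockCompletion.commute_of_bddBelow hBC hCB hDt hbdd
    have hmin := BlockCompletion.blockObjective_minimizer hBC hCB hD hcomm
    obtain ⟨H₀, hH₀⟩ : ∃ H₀, H₀ = -(Cᵀ * Matrix.diagonal ε * C) := ⟨_, rfl⟩
    rw [← hH₀] at hmin
    have hnorm : ‖H₀‖ = ‖Cᵀ * Matrix.diagonal ε * C‖ := by rw [hH₀, norm_neg]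
    have hsol : ∀ H, BlockCompletion.IsResidualSolution l Vb Vb Vp Vp ε
        (BlockCompletion.blockSelector n l * H * (BlockCompletion.blockSelector n l)ᵀ) →
        BlockCompletion.blockObjective B C (Matrix.diagonal ε) H ≤
          ((1 - C * Cᵀ) * Matrix.diagonal ε).trace := by
      intro H hH
      have h := hH.2 _ ((BlockCompletion.mask_hadamard_eq_zero_iff _).mpr ⟨H₀, rfl⟩)
      rwa [hobj, hobj, hmin] at h
    refine ⟨BlockCompletion.blockSelector n l * H₀ * (BlockCompletion.blockSelector n l)ᵀ, _,
      ⟨⟨(BlockCompletion.mask_hadamard_eq_zero_iff _).mpr ⟨H₀, rfl⟩, ?_⟩, ?_⟩,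
      BlockCompletion.isLeast_blockDualObjective hBC hCB hDt hcomm, ?_, ?_⟩
    · intro W' hW'
      obtain ⟨H, rfl⟩ := (BlockCompletion.mask_hadamard_eq_zero_iff _).mp hW'
      rw [hobj, hobj, hmin]
      exact BlockCompletion.le_blockObjective hC H
    · intro W' hW'
      obtain ⟨H, rfl⟩ := (BlockCompletion.mask_hadamard_eq_zero_iff _).mp hW'.1
      rw [BlockCompletion.norm_blockSelector_conj, BlockCompletion.norm_blockSelector_conj, hnorm]
      exact BlockCompletion.norm_le_of_blockObjective_le hBC hC hD (hsol H hW')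
    · rw [BlockCompletion.norm_blockSelector_conj, hnorm, neg_neg]
    · intro hs W' hW'
      obtain ⟨H, rfl⟩ := (BlockCompletion.mask_hadamard_eq_zero_iff _).mp hW'.1
      rw [BlockCompletion.eq_of_blockObjective_le hBC (hstrict hs) (hsol H hW'), hH₀]
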